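/- All linear spaces are real. For a locally convex space $X$, a *cylinder set* of $X$ is a set $u^{-1}(B)$ with $u\colon X\to\mathbf R^n$ continuous and linear, $n\ge 1$, and $B\subseteq\mathbf R^n$ Borel; the cylinder sets form an algebra. A *cylindrical probability* on $X$ is a nonnegative finitely additive set function $\mu$ of total mass $1$ on this algebra such that, for every continuous linear $u\colon X\to\mathbf R^n$, the function $B\mapsto\mu(u^{-1}(B))$ is countably additive on the Borel sets of $\mathbf R^n$. The image of $\mu$ under a continuous linear map $T\colon X\to X'$ is the cylindrical probability $T[\mu](C)=\mu(T^{-1}(C))$. **Theorem 2.** Let $Y$ and $Z$ be locally convex spaces and let $m$ be a cylindrical probability on $Y\times Z$ whose image $m_1=\pi_Y[m]$ under the canonical projection $\pi_Y\colon Y\times Z\to Y$ is countably additive on the algebra of cylinder sets of $Y$. Let $Q$, defined on the $\sigma$-algebra $\mathcal B$, be the completion of the countably additive extension of $m_1$ to the $\sigma$-algebra generated by the cylinder sets of $Y$. Then for every $n\ge 1$ and every continuous linear $b\colon Z\to\mathbf R^n$ the cylindrical probability $(I_Y\times b)[m]$ on $Y\times\mathbf R^n$ has a unique extension to a countably additive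 measure on the product $\sigma$-algebra of $\mathcal B$ and the Borel $\sigma$-algebra of $\mathbf R^n$; the extension is denoted by the same symbol. Moreover, there exists a family $\{m_y\}_{y\in Y}$ of cylindrical probabilities on $Z$ such that for every $n\ge 1$, every continuous linear $b\colon Z\to\mathbf R^n$ and every Borel set $E\subseteq\mathbf R^n$: (a) the function $y\mapsto b[m_y](E)$ is $\mathcal B$-measurable on $Y$; (b) for every $F\in\mathcal B$, $$(I_Y\times b)[m](F\times E)=\int_F b[m_y](E)\,dQ(y).$$ -/

import Mathlib

open MeasureTheory Set
open scoped ENNReal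

/-- The cylinder sets of a real topological vector space `E`: the sets `u ⁻¹' B` with
`u : E → ℝⁿ` continuous linear, `n` arbitrary, and `B` a Borel subset of `ℝⁿ`. -/
def cylinderSets (E : Type*) [AddCommGroup E] [Module ℝ E] [TopologicalSpace E] : Set (Set E) :=
  {C | ∃ (n : ℕ) (u : E →L[ℝ] (Fin n → ℝ)) (B : Set (Fin n → ℝ)),
    MeasurableSet B ∧ C = u ⁻¹' B}

section CylinderSets

variable {E F : Type*} [AddCommGroup E] [Module ℝ E] [TopologicalSpace E]
  [AddCommGroup F] [Module ℝ F] [TopologicalSpace F]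

theorem preimage_mem_cylinderSets {n : ℕ} (u : E →L[ℝ] (Fin n → ℝ)) {B : Set (Fin n → ℝ)}
    (hB : MeasurableSet B) : u ⁻¹' B ∈ cylinderSets E :=
  ⟨n, u, B, hB, rfl⟩

theorem preimage_mem_cylinderSets_of_mem (T : E →L[ℝ] F) {C : Set F} (hC : C ∈ cylinderSets F) :
    T ⁻¹' C ∈ cylinderSets E := by
  obtain ⟨n, u, B, hB, rfl⟩ := hC
  exact ⟨n, u.comp T, B, hB, rfl⟩

theorem empty_mem_cylinderSets : (∅ : Set E) ∈ cylinderSets E :=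
  ⟨0, 0, ∅, MeasurableSet.empty, rfl⟩

theorem univ_mem_cylinderSets : (univ : Set E) ∈ cylinderSets E :=
  ⟨0, 0, univ, MeasurableSet.univ, rfl⟩

/-- Two cylinder sets can be written with one and the same continuous linear map. -/
theorem exists_common_cylinder {C D : Set E} (hC : C ∈ cylinderSets E) (hD : D ∈ cylinderSets E) :
    ∃ (n : ℕ) (u : E →L[ℝ] (Fin n → ℝ)) (A B : Set (Fin n → ℝ)),
      MeasurableSet A ∧ MeasurableSet B ∧ C = u ⁻¹' A ∧ D = u ⁻¹' B := by
  obtain ⟨k, v, A, hA, rfl⟩ := hC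
  obtain ⟨l, w, B, hB, rfl⟩ := hD
  refine ⟨k + l, ContinuousLinearMap.pi (fun i => Fin.addCases
      (fun j => (ContinuousLinearMap.proj (R := ℝ) (φ := fun _ : Fin k => ℝ) j).comp v)
      (fun j => (ContinuousLinearMap.proj (R := ℝ) (φ := fun _ : Fin l => ℝ) j).comp w) i),
    (fun x i => x (Fin.castAdd l i)) ⁻¹' A, (fun x i => x (Fin.natAdd k i)) ⁻¹' B,
    hA.preimage (by fun_prop), hB.preimage (by fun_prop), ?_, ?_⟩
  · ext x
    simp
  · ext x
    simp

theorem isSetRing_cylinderSets : IsSetRing (cylinderSets E) where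
  empty_mem := empty_mem_cylinderSets
  union_mem := by
    intro C D hC hD
    obtain ⟨n, u, A, B, hA, hB, rfl, rfl⟩ := exists_common_cylinder hC hD
    exact ⟨n, u, A ∪ B, hA.union hB, rfl⟩
  sdiff_mem := by
    intro C D hC hD
    obtain ⟨n, u, A, B, hA, hB, rfl, rfl⟩ := exists_common_cylinder hC hD
    exact ⟨n, u, A \ B, hA.diff hB, rfl⟩

end CylinderSets

/-- A cylindrical probability on `E`: a nonnegative finitely additive set function of total mass
one on the algebra of cylinder sets, whose image `B ↦ content (u ⁻¹' B)` under every continuous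
linear `u : E → ℝⁿ` is countably additive on the Borel sets of `ℝⁿ`.
Only the values of `content` on cylinder sets carry information. -/
structure CylindricalProbability (E : Type*) [AddCommGroup E] [Module ℝ E]
    [TopologicalSpace E] where
  /-- The finitely additive set function. -/
  content : AddContent ℝ≥0∞ (cylinderSets E)
  content_univ : content univ = 1
  content_iUnion : ∀ (n : ℕ) (u : E →L[ℝ] (Fin n → ℝ)) (B : ℕ → Set (Fin n → ℝ)),
    (∀ i, MeasurableSet (B i)) → Pairwise (Function.onFun Disjoint B) →
      content (u ⁻¹' ⋃ i, B i) = ∑' i, content (u ⁻¹' B i)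

namespace CylindricalProbability

variable {E F : Type*} [AddCommGroup E] [Module ℝ E] [TopologicalSpace E]
  [AddCommGroup F] [Module ℝ F] [TopologicalSpace F]

noncomputable instance : FunLike (CylindricalProbability E) (Set E) ℝ≥0∞ where
  coe μ := μ.content
  coe_injective μ ν h := by
    cases μ
    cases ν
    congr
    exact DFunLike.coe_injective h

/-- The image `T[μ]` of a cylindrical probability under a continuous linear map `T`:
`T[μ] C = μ (T ⁻¹' C)` for every cylinder set `C`. -/
noncomputable def map (T : E →L[ℝ] F) (μ : CylindricalProbability E) :
    CylindricalProbability F where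
  content := isSetRing_cylinderSets.addContent_of_union (fun C => μ (T ⁻¹' C))
    (addContent_empty (m := μ.content))
    (by
      intro C D hC hD hCD
      exact addContent_union isSetRing_cylinderSets
        (preimage_mem_cylinderSets_of_mem T hC) (preimage_mem_cylinderSets_of_mem T hD)
        (hCD.preimage T))
  content_univ := μ.content_univ
  content_iUnion := fun n u B hB hd => μ.content_iUnion n (u.comp T) B hB hd

@[simp]
theorem map_apply (T : E →L[ℝ] F) (μ : CylindricalProbability E) (C : Set F) :
    μ.map T C = μ (T ⁻¹' C) := rfl

/-- `μ` is countably additive on the algebra of cylinder sets. -/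
def IsCountablyAdditive (μ : CylindricalProbability E) : Prop :=
  ∀ C : ℕ → Set E, (∀ i, C i ∈ cylinderSets E) → Pairwise (Function.onFun Disjoint C) →
    (⋃ i, C i) ∈ cylinderSets E → μ (⋃ i, C i) = ∑' i, μ (C i)

/-- The countably additive extension of a countably additive cylindrical probability to the
sigma-algebra generated by the cylinder sets (Carathéodory extension). -/
noncomputable def IsCountablyAdditive.extension {μ : CylindricalProbability E}
    (hμ : μ.IsCountablyAdditive) :
    @Measure E (MeasurableSpace.generateFrom (cylinderSets E)) :=
  letI : MeasurableSpace E := MeasurableSpace.generateFrom (cylinderSets E)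
  μ.content.measure isSetRing_cylinderSets.isSetSemiring le_rfl
    (isSigmaSubadditive_of_addContent_iUnion_eq_tsum isSetRing_cylinderSets
      (fun C hC hU hd => hμ C hC hd hU))

/-- The domain of the completion of `hμ.extension`: the sets that differ from a set of the
sigma-algebra generated by the cylinder sets by a null set. -/
@[reducible] noncomputable def IsCountablyAdditive.completedSigmaAlgebra {μ : CylindricalProbability E}
    (hμ : μ.IsCountablyAdditive) : MeasurableSpace E :=
  letI : MeasurableSpace E := MeasurableSpace.generateFrom (cylinderSets E)
  (inferInstance : MeasurableSpace (NullMeasurableSpace E hμ.extension))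

/-- The completion of `hμ.extension`, a complete measure on `hμ.completedSigmaAlgebra`. -/
noncomputable def IsCountablyAdditive.completedMeasure {μ : CylindricalProbability E}
    (hμ : μ.IsCountablyAdditive) : @Measure E hμ.completedSigmaAlgebra :=
  letI : MeasurableSpace E := MeasurableSpace.generateFrom (cylinderSets E)
  hμ.extension.completion

/-- The measure `S` extends the cylindrical probability `μ`: every cylinder set belongs to the
domain of `S`, and `S` and `μ` agree on it. -/
def IsExtendedBy [MeasurableSpace E] (μ : CylindricalProbability E) (S : Measure E) : Prop :=
  ∀ C ∈ cylinderSets E, MeasurableSet C ∧ S C = μ C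

end CylindricalProbability

/-!
The family `m_y` is obtained from a disintegration that is consistent for every `y`, and for all
finite-dimensional images at once, so that no exceptional null sets have to be reconciled.

A Hamel basis `e : ι → Z'` of the continuous dual of `Z` maps `Z` to `ι → ℝ`, and every continuous
linear `b : Z → ℝⁿ` factors through this map by a linear map `basisLift e b` that depends on
finitely many coordinates. Conversely, finitely many members of `Z'` cannot separate a point of
`ι → ℝ` from the image of `Z` (`exists_apply_eq_basisLift`). Hence every probability measure on
`ι → ℝ` gives a cylindrical probability on `Z` (`exists_cylindricalProbability_preimage`), and it
suffices to disintegrate the image of `m` on `Y × (ι → ℝ)`.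

This image is countably additive because its marginal on `Y` is
(`CylindricalProbability.IsCountablyAdditive.of_map_fst`): cylinder sets of positive content are
approximated by sets whose sections over `Y` are compact, and whose projections to `Y` are again
cylinder sets. A decreasing sequence of such projections has a common point by countable additivity
on `Y`, and over that point Tychonoff's theorem applies.

For uncountable `ι` the space `ι → ℝ` is not standard Borel, but a measure `ρ` on `Y × (ι → ℝ)`
still has a conditional kernel (`exists_kernel_compProd_eq`). Well-order `ι` and take independent
uniform variables `u i`. The conditional law of coordinate `i` given `y` and the coordinates below
`i` is the law of `f i (y, x_{<i}) u` for a measurable `f i`, so the well-founded recursion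
`X i = f i (y, (X k)_{k < i}) (u i)` defines a measurable family with the law prescribed by `ρ`, and
the kernel is the law of `X` for fixed `y`.

Finally, any measure `S` extending the image of `m` on `Y × ℝⁿ` is determined on rectangles by this
kernel (`CylindricalProbability.isExtendedBy_apply_prod`), which gives uniqueness and the integral
formula together, and the composition of the completed measure with the kernel is such an `S`.
-/

open ProbabilityTheory

/-! ### Disintegration in powers of a standard Borel space -/

section Disintegration

theorem measurable_update_prod {ι : Type*} [DecidableEq ι] {T : ι → Type*}
    [∀ i, MeasurableSpace (T i)] (j : ι) :
    Measurable fun p : (∀ i, T i) × T j => Function.update p.1 j p.2 := by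
  rw [measurable_pi_iff]
  intro i
  by_cases h : i = j
  · subst h
    simpa using measurable_snd
  · simp only [Function.update_of_ne h]
    fun_prop

/-- Replacing one coordinate by an independent copy of it does not change a product measure. -/
theorem infinitePi_map_update {ι : Type*} [DecidableEq ι] {T : ι → Type*}
    [∀ i, MeasurableSpace (T i)] (P : ∀ i, Measure (T i)) [∀ i, IsProbabilityMeasure (P i)]
    (j : ι) :
    ((Measure.infinitePi P).prod (P j)).map (fun p => Function.update p.1 j p.2) =
      Measure.infinitePi P := by
  refine Measure.eq_infinitePi P fun s t ht => ?_
  rw [Measure.map_apply (measurable_update_prod j)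
    (MeasurableSet.pi s.countable_toSet fun i _ => ht i)]
  have hpre : (fun p : (∀ i, T i) × T j => Function.update p.1 j p.2) ⁻¹' (Set.pi s t) =
      (Set.pi (s.erase j : Finset ι) t) ×ˢ (if j ∈ s then t j else univ) := by
    ext ⟨x, y⟩
    simp only [mem_preimage, Set.mem_pi, mem_prod, Finset.mem_coe, Finset.mem_erase]
    constructor
    · intro h
      refine ⟨fun i hi => ?_, ?_⟩
      · have := h i hi.2
        rwa [Function.update_of_ne hi.1] at this
      · split_ifs with hj
        · simpa using h j hj
        · trivial
    · rintro ⟨h1, h2⟩ i hi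
      by_cases h : i = j
      · subst h
        simpa [hi] using h2
      · rw [Function.update_of_ne h]
        exact h1 i ⟨h, hi⟩
  rw [hpre, Measure.prod_prod, Measure.infinitePi_pi P (fun i _ => ht i)]
  split_ifs with hj
  · exact Finset.prod_erase_mul s _ hj
  · rw [measure_univ, mul_one, Finset.erase_eq_of_notMem hj]

/-- A finite measure on `α × (ι → Ω)` is determined by its images under the restrictions of the
second factor to finite sets of coordinates. -/
theorem ext_of_map_restrict {α ι Ω : Type*} [MeasurableSpace α] [MeasurableSpace Ω]
    {μ ν : Measure (α × (ι → Ω))} [IsFiniteMeasure μ] [IsFiniteMeasure ν]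
    (h : ∀ J : Finset ι, μ.map (Prod.map id (J.restrict (π := fun _ => Ω))) =
      ν.map (Prod.map id (J.restrict (π := fun _ => Ω)))) : μ = ν := by
  refine Measure.ext_prod fun {s t} hs ht => ?_
  have key : (μ.restrict (s ×ˢ univ)).snd = (ν.restrict (s ×ˢ univ)).snd := by
    refine IsProjectiveLimit.unique
      (P := fun J => (μ.restrict (s ×ˢ univ)).snd.map J.restrict) (fun _ => rfl) fun J => ?_
    ext B hB
    have aux (η : Measure (α × (ι → Ω))) :
        (η.restrict (s ×ˢ univ)).snd.map J.restrict B =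
          η.map (Prod.map id (J.restrict (π := fun _ => Ω))) (s ×ˢ B) := by
      rw [Measure.map_apply (by fun_prop) hB, Measure.snd_apply (hB.preimage (by fun_prop)),
        Measure.restrict_apply ((hB.preimage (by fun_prop)).preimage (by fun_prop)),
        Measure.map_apply (by fun_prop) (hs.prod hB)]
      congr 1
      ext
      simp [and_comm]
    rw [aux, aux, h J]
  have aux (η : Measure (α × (ι → Ω))) : (η.restrict (s ×ˢ univ)).snd t = η (s ×ˢ t) := by
    rw [Measure.snd_apply ht, Measure.restrict_apply (ht.preimage measurable_snd)]
    congr 1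
    ext
    simp [and_comm]
  rw [← aux, ← aux, key]

/-- Disintegration with values in a power of a standard Borel space, for an index set of any
size. -/
theorem exists_kernel_compProd_eq {α ι Ω : Type*} [MeasurableSpace α] [MeasurableSpace Ω]
    [StandardBorelSpace Ω] [Nonempty Ω] (ρ : Measure (α × (ι → Ω))) [IsProbabilityMeasure ρ] :
    ∃ κ : Kernel α (ι → Ω), IsMarkovKernel κ ∧ ρ.fst ⊗ₘ κ = ρ := by
  classical
  obtain ⟨_, _⟩ := exists_wellFoundedLT ι
  let R (j : ι) : Measure ((α × (Iio j → Ω)) × Ω) :=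
    ρ.map fun p => ((p.1, fun k => p.2 k), p.2 j)
  have hRm (j : ι) : Measurable fun p : α × (ι → Ω) =>
    (((p.1, fun k => p.2 k), p.2 j) : (α × (Iio j → Ω)) × Ω) := by fun_prop
  have hR (j : ι) : IsProbabilityMeasure (R j) :=
    Measure.isProbabilityMeasure_map (hRm j).aemeasurable
  choose f hf hfR using fun j => Kernel.exists_measurable_map_eq_unitInterval (R j).condKernel
  obtain ⟨X, hX⟩ : ∃ X : ι → α × (ι → unitInterval) → Ω,
      ∀ i p, X i p = f i (p.1, fun k : Iio i => X k p) (p.2 i) :=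
    ⟨(wellFounded_lt (α := ι)).fix fun i rec p =>
        f i (p.1, fun k : Iio i => rec k.1 k.2 p) (p.2 i),
      fun i p => congrFun ((wellFounded_lt (α := ι)).fix_eq
        (fun i (rec : ∀ k, k < i → α × (ι → unitInterval) → Ω) p =>
          f i (p.1, fun k : Iio i => rec k.1 k.2 p) (p.2 i)) i) p⟩
  have hXm (i : ι) : Measurable (X i) := by
    induction i using (wellFounded_lt (α := ι)).induction with
    | _ i ih =>
      have h1 : X i = fun p => Function.uncurry (f i)
          ((p.1, fun k : Iio i => X k p), p.2 i) := funext (hX i)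
      rw [h1]
      have h2 : Measurable fun p => fun k : Iio i => X k p :=
        measurable_pi_iff.2 fun k => ih k k.2
      exact (hf i).comp ((measurable_fst.prodMk h2).prodMk (by fun_prop))
  have hXupd (j i : ι) (hij : i < j) (p : α × (ι → unitInterval)) (t : unitInterval) :
      X i (p.1, Function.update p.2 j t) = X i p := by
    induction i using (wellFounded_lt (α := ι)).induction with
    | _ i ih =>
      rw [hX, hX i p]
      congr 2
      · ext k
        exact ih k k.2 (lt_trans k.2 hij)
      · exact Function.update_of_ne hij.ne _ _
  let P : Measure (ι → unitInterval) := Measure.infinitePi fun _ => volume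
  let M : Measure (α × (ι → unitInterval)) := ρ.fst.prod P
  -- The law of `(X k)_{k ∈ S}` is determined by its finite marginals, and a nonempty finite set
  -- with largest element `j` lies in `{k | k ≤ j}`.
  have hlaw (S : Set ι)
      (h : ∀ j ∈ S, M.map (fun p => ((p.1, fun k : Iio j => X k p), X j p)) = R j) :
      M.map (fun p => (p.1, fun k : S => X k p)) = ρ.map fun p => (p.1, fun k : S => p.2 k) := by
    have hm1 : Measurable fun p : α × (ι → unitInterval) => (p.1, fun k : S => X k p) :=
      measurable_fst.prodMk (measurable_pi_iff.2 fun k => hXm k)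
    have hm2 : Measurable fun p : α × (ι → Ω) => (p.1, fun k : S => p.2 k) := by fun_prop
    have := Measure.isProbabilityMeasure_map (μ := M) hm1.aemeasurable
    have := Measure.isProbabilityMeasure_map (μ := ρ) hm2.aemeasurable
    refine ext_of_map_restrict fun J => ?_
    rw [Measure.map_map (by fun_prop) hm1, Measure.map_map (by fun_prop) hm2]
    rcases J.eq_empty_or_nonempty with rfl | hJ
    · have h1 : M.map (Prod.fst) = ρ.map Prod.fst := by
        change M.fst = ρ.fst
        exact Measure.fst_prod
      let g : α → α × ((∅ : Finset S) → Ω) :=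
        fun a => (a, fun k => absurd k.2 (Finset.notMem_empty _))
      have hg : Measurable g := measurable_id.prodMk measurable_const
      have hl := congrArg (Measure.map g) h1
      rw [Measure.map_map hg measurable_fst, Measure.map_map hg measurable_fst] at hl
      convert hl using 2
      · ext p : 1
        exact Prod.ext rfl (Subsingleton.elim _ _)
      · ext p : 1
        exact Prod.ext rfl (Subsingleton.elim _ _)
    · let j := J.max' hJ
      let g : (α × (Iio j.1 → Ω)) × Ω → α × (J → Ω) := fun q => (q.1.1, fun k =>
        if hk : k.1 = j then q.2
        else q.1.2 ⟨k.1, lt_of_le_of_ne (J.le_max' k.1 k.2) (Subtype.coe_ne_coe.2 hk)⟩)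
      have hg : Measurable g := by
        refine (measurable_fst.comp measurable_fst).prodMk (measurable_pi_iff.2 fun k => ?_)
        by_cases hk : k.1 = j
        · simpa only [hk, dite_true] using measurable_snd
        · simp only [hk, dite_false]
          fun_prop
      have hl := congrArg (Measure.map g) (h j j.2)
      rw [Measure.map_map hg ((measurable_fst.prodMk
        (measurable_pi_iff.2 fun k => hXm k.1)).prodMk (hXm _)),
        Measure.map_map hg (hRm _)] at hl
      convert hl using 2
      · ext p : 1
        refine Prod.ext rfl (funext fun k => ?_)
        by_cases hk : k.1 = j
        · simp [g, hk]
        · simp [g, hk]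
      · ext p : 1
        refine Prod.ext rfl (funext fun k => ?_)
        by_cases hk : k.1 = j
        · simp [g, hk]
        · simp [g, hk]
  have hstep (j : ι) : M.map (fun p => ((p.1, fun k : Iio j => X k p), X j p)) = R j := by
    induction j using (wellFounded_lt (α := ι)).induction with
    | _ j ih =>
      let W : α × (ι → unitInterval) → α × (Iio j → Ω) := fun p => (p.1, fun k => X k p)
      have hW : Measurable W :=
        measurable_fst.prodMk (measurable_pi_iff.2 fun k => hXm k)
      have hfst : M.map W = (R j).fst := by
        rw [hlaw (Iio j) ih, Measure.fst, Measure.map_map measurable_fst (hRm j)]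
        rfl
      -- Resampling the coordinate `j` shows that it is independent of `W`.
      have hindep : M.map (fun p => (W p, p.2 j)) = (M.map W).prod volume := by
        have hupd : Measurable fun q : (α × (ι → unitInterval)) × unitInterval =>
            (q.1.1, Function.update q.1.2 j q.2) :=
          (measurable_fst.comp measurable_fst).prodMk ((measurable_update_prod j).comp
            ((measurable_snd.comp measurable_fst).prodMk measurable_snd))
        have hM : M = (M.prod volume).map
            (fun q : (α × (ι → unitInterval)) × unitInterval =>
              (q.1.1, Function.update q.1.2 j q.2)) := by
          have h1 : (fun q : (α × (ι → unitInterval)) × unitInterval =>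
              (q.1.1, Function.update q.1.2 j q.2)) =
              Prod.map id (fun q : (ι → unitInterval) × unitInterval =>
                Function.update q.1 j q.2) ∘ MeasurableEquiv.prodAssoc := rfl
          rw [h1, ← Measure.map_map (measurable_id.prodMap (measurable_update_prod j))
            MeasurableEquiv.prodAssoc.measurable, Measure.prodAssoc_prod,
            ← Measure.map_prod_map _ _ measurable_id (measurable_update_prod j), Measure.map_id]
          rw [infinitePi_map_update (fun _ : ι => (volume : Measure unitInterval)) j]
        conv_lhs => rw [hM]
        rw [Measure.map_map (hW.prodMk (by fun_prop)) hupd]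
        have : (fun p => (W p, p.2 j)) ∘ (fun q : (α × (ι → unitInterval)) × unitInterval =>
            (q.1.1, Function.update q.1.2 j q.2)) = Prod.map W id := by
          ext q : 1
          refine Prod.ext (Prod.ext rfl (funext fun k => ?_)) ?_
          · exact hXupd j k k.2 q.1 q.2
          · simp
        rw [this, ← Measure.map_prod_map _ _ hW measurable_id, Measure.map_id]
      have hcomp : (fun p => ((p.1, fun k : Iio j => X k p), X j p)) =
          (fun q : (α × (Iio j → Ω)) × unitInterval => (q.1, f j q.1 q.2)) ∘
            fun p => (W p, p.2 j) := by
        ext p : 1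
        exact Prod.ext rfl (hX j p)
      have hfm : Measurable fun q : (α × (Iio j → Ω)) × unitInterval => (q.1, f j q.1 q.2) :=
        measurable_fst.prodMk (hf j)
      rw [hcomp, ← Measure.map_map hfm (hW.prodMk (by fun_prop)), hindep, hfst]
      conv_rhs => rw [← (R j).disintegrate (R j).condKernel]
      ext A hA
      rw [Measure.map_apply hfm hA, Measure.prod_apply (hA.preimage hfm),
        Measure.compProd_apply hA]
      refine lintegral_congr fun w => ?_
      rw [← hfR j w, Measure.map_apply ((hf j).of_uncurry_left)
        (hA.preimage measurable_prodMk_left)]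
      rfl
  have hXall : Measurable fun p => (fun i => X i p) := measurable_pi_iff.2 hXm
  refine ⟨(Kernel.id ×ₖ Kernel.const α P).map fun p i => X i p, Kernel.IsMarkovKernel.map _ hXall,
    ?_⟩
  have hall := congrArg
    (Measure.map (Prod.map id fun (x : ↥(univ : Set ι) → Ω) (i : ι) => x ⟨i, mem_univ i⟩))
    (hlaw univ fun j _ => hstep j)
  rw [Measure.map_map (by fun_prop)
      (measurable_fst.prodMk (measurable_pi_iff.2 fun k : ↥(univ : Set ι) => hXm k)),
    Measure.map_map (by fun_prop) (by fun_prop)] at hall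
  have hρ : M.map (fun p => (p.1, fun i => X i p)) = ρ := hall.trans Measure.map_id
  conv_rhs => rw [← hρ]
  ext A hA
  have hm : Measurable fun p => (p.1, fun i => X i p) := measurable_fst.prodMk hXall
  rw [Measure.compProd_apply hA, Measure.map_apply hm hA, Measure.prod_apply (hA.preimage hm)]
  refine lintegral_congr fun a => ?_
  rw [Kernel.map_apply' _ hXall _ (hA.preimage measurable_prodMk_left), Kernel.prod_apply,
    Kernel.id_apply, Kernel.const_apply, Measure.dirac_prod, Measure.map_apply
      measurable_prodMk_left ((hA.preimage measurable_prodMk_left).preimage hXall)]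
  rfl

end Disintegration

/-! ### Finite-dimensional images and extensions of cylindrical probabilities -/

section FiniteDimensional

variable {E : Type*} [AddCommGroup E] [Module ℝ E] [TopologicalSpace E]
  {V : Type*} [NormedAddCommGroup V] [NormedSpace ℝ V] [FiniteDimensional ℝ V]
  [MeasurableSpace V] [BorelSpace V]

theorem exists_continuousLinearEquiv_pi (V : Type*) [NormedAddCommGroup V] [NormedSpace ℝ V]
    [FiniteDimensional ℝ V] : Nonempty (V ≃L[ℝ] (Fin (Module.finrank ℝ V) → ℝ)) :=
  ⟨ContinuousLinearEquiv.ofFinrankEq (by simp)⟩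

theorem preimage_mem_cylinderSets_of_finiteDimensional (u : E →L[ℝ] V) {B : Set V}
    (hB : MeasurableSet B) : u ⁻¹' B ∈ cylinderSets E := by
  obtain ⟨e⟩ := exists_continuousLinearEquiv_pi V
  refine ⟨_, (e : V →L[ℝ] _).comp u, e.symm ⁻¹' B, hB.preimage e.symm.continuous.measurable, ?_⟩
  ext x
  simp

theorem measurable_generateFrom_cylinderSets (u : E →L[ℝ] V) :
    Measurable[MeasurableSpace.generateFrom (cylinderSets E)] u := fun _ hB =>
  MeasurableSpace.measurableSet_generateFrom
    (preimage_mem_cylinderSets_of_finiteDimensional u hB)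

/-- The image of a cylindrical probability under a continuous linear map to a finite-dimensional
space, as a Borel measure. -/
noncomputable def CylindricalProbability.law (μ : CylindricalProbability E) (u : E →L[ℝ] V) :
    Measure V :=
  Measure.ofMeasurable (fun B _ => μ (u ⁻¹' B)) (addContent_empty (m := μ.content)) (by
    intro B hB hd
    obtain ⟨e⟩ := exists_continuousLinearEquiv_pi V
    have h := μ.content_iUnion _ ((e : V →L[ℝ] _).comp u) (fun i => e.symm ⁻¹' B i)
      (fun i => (hB i).preimage e.symm.continuous.measurable)
      (fun i j hij => (hd hij).preimage _)
    have hp (A : Set V) : ((e : V →L[ℝ] _).comp u) ⁻¹' (e.symm ⁻¹' A) = u ⁻¹' A := by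
      ext x
      simp
    rw [← preimage_iUnion] at h
    simp only [hp] at h
    exact h)

theorem CylindricalProbability.law_apply (μ : CylindricalProbability E) (u : E →L[ℝ] V) {B : Set V}
    (hB : MeasurableSet B) : μ.law u B = μ (u ⁻¹' B) :=
  Measure.ofMeasurable_apply B hB

instance (μ : CylindricalProbability E) (u : E →L[ℝ] V) : IsProbabilityMeasure (μ.law u) :=
  ⟨by rw [μ.law_apply u MeasurableSet.univ]; exact μ.content_univ⟩

end FiniteDimensional

section Mono

variable {E : Type*} [AddCommGroup E] [Module ℝ E] [TopologicalSpace E]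

theorem CylindricalProbability.mono (μ : CylindricalProbability E) {C D : Set E}
    (hC : C ∈ cylinderSets E) (hD : D ∈ cylinderSets E) (h : C ⊆ D) : μ C ≤ μ D :=
  addContent_mono isSetRing_cylinderSets.isSetSemiring hC hD h

theorem CylindricalProbability.apply_le_one (μ : CylindricalProbability E) {C : Set E}
    (hC : C ∈ cylinderSets E) : μ C ≤ 1 :=
  (μ.mono hC univ_mem_cylinderSets (subset_univ _)).trans_eq μ.content_univ

theorem CylindricalProbability.IsCountablyAdditive.extension_apply {μ : CylindricalProbability E}
    (hμ : μ.IsCountablyAdditive) {C : Set E} (hC : C ∈ cylinderSets E) :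
    hμ.extension C = μ C :=
  letI : MeasurableSpace E := MeasurableSpace.generateFrom (cylinderSets E)
  μ.content.measure_eq isSetRing_cylinderSets.isSetSemiring rfl
    (isSigmaSubadditive_of_addContent_iUnion_eq_tsum isSetRing_cylinderSets
      (fun C hC hU hd => hμ C hC hd hU)) hC

theorem CylindricalProbability.IsCountablyAdditive.isProbabilityMeasure_extension
    {μ : CylindricalProbability E} (hμ : μ.IsCountablyAdditive) :
    IsProbabilityMeasure hμ.extension :=
  letI : MeasurableSpace E := MeasurableSpace.generateFrom (cylinderSets E)
  ⟨(hμ.extension_apply univ_mem_cylinderSets).trans μ.content_univ⟩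

end Mono

/-! ### Countable additivity on `Y × (ι → ℝ)` -/

section CountableAdditivity

/-- A continuous linear map from a power of `ℝ` to a normed space depends on finitely many
coordinates only. -/
theorem exists_finset_eq_of_eqOn {ι V : Type*} [NormedAddCommGroup V] [NormedSpace ℝ V]
    (v : (ι → ℝ) →L[ℝ] V) :
    ∃ J : Finset ι, ∀ x x' : ι → ℝ, (∀ i ∈ J, x i = x' i) → v x = v x' := by
  have h0 : v ⁻¹' Metric.ball 0 1 ∈ nhds (0 : ι → ℝ) :=
    v.continuous.continuousAt.preimage_mem_nhds (by simpa using Metric.ball_mem_nhds 0 one_pos)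
  rw [nhds_pi, Filter.mem_pi'] at h0
  obtain ⟨J, t, ht, hJ⟩ := h0
  refine ⟨J, fun x x' h => sub_eq_zero.1 ?_⟩
  rw [← map_sub]
  by_contra hne
  have hpos : 0 < ‖v (x - x')‖ := norm_pos_iff.2 hne
  have hmem : (‖v (x - x')‖⁻¹ • (x - x')) ∈ v ⁻¹' Metric.ball 0 1 := by
    refine hJ fun i hi => ?_
    simpa [h i hi] using mem_of_mem_nhds (ht i)
  simp [norm_smul, hpos.ne', -map_sub] at hmem

variable {Y ι : Type*} [AddCommGroup Y] [Module ℝ Y] [TopologicalSpace Y]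

/-- If the first marginal of `μ` is countably additive, a decreasing sequence of cylinder sets whose
contents are bounded below has a common point. -/
theorem CylindricalProbability.nonempty_iInter_of_map_fst
    {μ : CylindricalProbability (Y × (ι → ℝ))}
    (hμ : (μ.map (ContinuousLinearMap.fst ℝ Y (ι → ℝ))).IsCountablyAdditive)
    {s : ℕ → Set (Y × (ι → ℝ))} (hs : ∀ k, s k ∈ cylinderSets (Y × (ι → ℝ))) (hanti : Antitone s)
    {ε : ℝ≥0∞} (hε : ε ≠ 0) (hle : ∀ k, ε ≤ μ (s k)) : (⋂ k, s k).Nonempty := by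
  classical
  choose d w B hB hsB using hs
  let u (k : ℕ) : Y →L[ℝ] (Fin (d k) → ℝ) := (w k).comp (ContinuousLinearMap.inl ℝ Y (ι → ℝ))
  let v (k : ℕ) : (ι → ℝ) →L[ℝ] (Fin (d k) → ℝ) :=
    (w k).comp (ContinuousLinearMap.inr ℝ Y (ι → ℝ))
  have huv (k : ℕ) (y : Y) (x : ι → ℝ) : w k (y, x) = u k y + v k x := by
    simp [u, v, ← map_add]
  choose J hJ using fun k => exists_finset_eq_of_eqOn (v k)
  let r (k : ℕ) : (ι → ℝ) →L[ℝ] (J k → ℝ) :=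
    ContinuousLinearMap.pi fun i => ContinuousLinearMap.proj i.1
  let q (k : ℕ) : Y × (ι → ℝ) →L[ℝ] (Fin (d k) → ℝ) × (J k → ℝ) :=
    (w k).prod ((r k).comp (ContinuousLinearMap.snd ℝ Y (ι → ℝ)))
  obtain ⟨δ, hδ, hδε⟩ := ENNReal.exists_pos_sum_of_countable hε ℕ
  have hBq (k : ℕ) : MeasurableSet (Prod.fst ⁻¹' B k : Set ((Fin (d k) → ℝ) × (J k → ℝ))) :=
    (hB k).preimage measurable_fst
  choose K hKB hKc hKδ using fun k =>
    (hBq k).exists_isCompact_sdiff_lt (measure_ne_top (μ.law (q k)) _)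
      (ENNReal.coe_ne_zero.2 (hδ k).ne')
  -- Coordinate `i` is confined to a compact set read off from the first `K k` that involves it.
  -- Adjoining `0` allows setting all coordinates that have not yet been involved to `0`.
  let T (i : ι) : Set ℝ := if h : ∃ k, i ∈ J k then
    insert 0 ((fun p => p.2 ⟨i, Nat.find_spec h⟩) '' K (Nat.find h)) else {0}
  have hTc (i : ι) : IsCompact (T i) := by
    by_cases h : ∃ k, i ∈ J k
    · simp only [T, h, dite_true]
      exact ((hKc _).image (by fun_prop)).insert 0
    · simp only [T, h, dite_false]
      exact isCompact_singleton
  have hT0 (i : ι) : 0 ∈ T i := by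
    by_cases h : ∃ k, i ∈ J k <;> simp [T, h]
  have hRc : IsCompact (Set.pi univ T) := isCompact_univ_pi hTc
  -- The projection to `Y` of the first `k + 1` compact conditions on `(y, x)` with `x ∈ ∏ T i`.
  let A (k : ℕ) : Set Y :=
    {y | ∃ x ∈ Set.pi univ T, ∀ j : Fin (k + 1), (u j y + v j x, r j x) ∈ K j}
  have hAcyl (k : ℕ) : A k ∈ cylinderSets Y := by
    let P : Set (∀ j : Fin (k + 1), Fin (d j) → ℝ) :=
      {a | ∃ x ∈ Set.pi univ T, ∀ j : Fin (k + 1), (a j + v j x, r j x) ∈ K j}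
    have hP : IsClosed P := by
      have := isCompact_iff_compactSpace.1 hRc
      have hcl : IsClosed {p : (∀ j : Fin (k + 1), Fin (d j) → ℝ) × Set.pi univ T |
          ∀ j : Fin (k + 1), (p.1 j + v j p.2, r j p.2) ∈ K j} := by
        simp only [ofPred_forall]
        exact isClosed_iInter fun j => (hKc j).isClosed.preimage (by fun_prop)
      convert isClosedMap_fst_of_compactSpace _ hcl
      ext a
      simp [P]
    exact preimage_mem_cylinderSets_of_finiteDimensional
      (ContinuousLinearMap.pi fun j : Fin (k + 1) => u j) hP.measurableSet
  have hAanti : Antitone A := by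
    rintro k l hkl y ⟨x, hx, h⟩
    exact ⟨x, hx, fun j => h (Fin.castLE (by omega) j)⟩
  have hcover (k : ℕ) : s k ⊆ (Prod.fst ⁻¹' A k) ∪
      ⋃ j ∈ Finset.range (k + 1), q j ⁻¹' (Prod.fst ⁻¹' B j \ K j) := by
    rintro ⟨y, x⟩ hyx
    by_cases hbad : ∃ j ∈ Finset.range (k + 1), q j (y, x) ∉ K j
    · obtain ⟨j, hj, hjK⟩ := hbad
      right
      simp only [mem_iUnion]
      refine ⟨j, hj, ?_, hjK⟩
      have := hanti (Nat.lt_succ_iff.1 (Finset.mem_range.1 hj)) hyx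
      rw [hsB j] at this
      exact this
    · left
      push Not at hbad
      let x' : ι → ℝ := fun i => if ∃ j ∈ Finset.range (k + 1), i ∈ J j then x i else 0
      have hxx' (j : ℕ) (hj : j ∈ Finset.range (k + 1)) (i : ι) (hi : i ∈ J j) : x' i = x i :=
        if_pos ⟨j, hj, hi⟩
      refine ⟨x', fun i _ => ?_, fun j => ?_⟩
      · by_cases hi : ∃ j ∈ Finset.range (k + 1), i ∈ J j
        · have hx'i : x' i = x i := if_pos hi
          obtain ⟨j, hj, hij⟩ := hi
          have hex : ∃ k, i ∈ J k := ⟨j, hij⟩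
          simp only [T, hex, dite_true, hx'i]
          right
          refine ⟨q (Nat.find hex) (y, x), hbad _ ?_, rfl⟩
          have := Nat.find_min' hex hij
          simp only [Finset.mem_range] at hj ⊢
          omega
        · have hx'i : x' i = 0 := if_neg hi
          rw [hx'i]
          exact hT0 i
      · have hj : (j : ℕ) ∈ Finset.range (k + 1) := Finset.mem_range.2 j.2
        have h1 : v j x' = v j x := hJ _ _ _ (hxx' j hj)
        have h2 : r j x' = r j x := funext fun i => hxx' j hj i i.2
        have h3 := hbad j hj
        rw [h1, h2, ← huv]
        exact h3
  have hAle (k : ℕ) : ε - ∑' j, (δ j : ℝ≥0∞) ≤ hμ.extension (A k) := by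
    rw [hμ.extension_apply (hAcyl k), map_apply, tsub_le_iff_right]
    have hqcyl (j : ℕ) : q j ⁻¹' (Prod.fst ⁻¹' B j \ K j) ∈ cylinderSets (Y × (ι → ℝ)) :=
      preimage_mem_cylinderSets_of_finiteDimensional _ ((hBq j).diff (hKc j).measurableSet)
    have hfcyl := preimage_mem_cylinderSets_of_mem (ContinuousLinearMap.fst ℝ Y (ι → ℝ)) (hAcyl k)
    have hU := isSetRing_cylinderSets.biUnion_mem (Finset.range (k + 1)) fun j _ => hqcyl j
    calc ε ≤ μ (s k) := hle k
      _ ≤ μ ((Prod.fst ⁻¹' A k) ∪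
          ⋃ j ∈ Finset.range (k + 1), q j ⁻¹' (Prod.fst ⁻¹' B j \ K j)) :=
        μ.mono (hsB k ▸ preimage_mem_cylinderSets _ (hB k))
          (isSetRing_cylinderSets.union_mem hfcyl hU) (hcover k)
      _ ≤ μ (Prod.fst ⁻¹' A k) +
          μ (⋃ j ∈ Finset.range (k + 1), q j ⁻¹' (Prod.fst ⁻¹' B j \ K j)) :=
        addContent_union_le isSetRing_cylinderSets hfcyl hU
      _ ≤ μ (Prod.fst ⁻¹' A k) +
          ∑ j ∈ Finset.range (k + 1), μ (q j ⁻¹' (Prod.fst ⁻¹' B j \ K j)) := by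
        gcongr
        exact addContent_biUnion_le isSetRing_cylinderSets fun j _ => hqcyl j
      _ ≤ μ (Prod.fst ⁻¹' A k) + ∑' j, (δ j : ℝ≥0∞) := by
        gcongr
        refine (Finset.sum_le_sum fun j _ => ?_).trans (ENNReal.sum_le_tsum _)
        rw [← μ.law_apply (q j) ((hBq j).diff (hKc j).measurableSet)]
        exact (hKδ j).le
  obtain ⟨y, hy⟩ : (⋂ k, A k).Nonempty := by
    let _ : MeasurableSpace Y := MeasurableSpace.generateFrom (cylinderSets Y)
    have := hμ.isProbabilityMeasure_extension
    refine nonempty_of_measure_ne_zero (μ := hμ.extension) ?_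
    rw [hAanti.measure_iInter (fun k => (MeasurableSpace.measurableSet_generateFrom
      (hAcyl k)).nullMeasurableSet) ⟨0, measure_ne_top _ _⟩]
    exact ((tsub_pos_of_lt hδε).trans_le (le_iInf hAle)).ne'
  rw [mem_iInter] at hy
  obtain ⟨x, hx⟩ := IsCompact.nonempty_iInter_of_sequence_nonempty_isCompact_isClosed
    (fun k => Set.pi univ T ∩ {x | ∀ j : Fin (k + 1), (u j y + v j x, r j x) ∈ K j})
    (fun k x hx => ⟨hx.1, fun j => hx.2 j.castSucc⟩)
    (fun k => let ⟨x, hx, h⟩ := hy k; ⟨x, hx, h⟩)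
    (hRc.inter_right (by
      simp only [ofPred_forall]
      exact isClosed_iInter fun j => (hKc j).isClosed.preimage (by fun_prop)))
    (fun k => hRc.isClosed.inter (by
      simp only [ofPred_forall]
      exact isClosed_iInter fun j => (hKc j).isClosed.preimage (by fun_prop)))
  rw [mem_iInter] at hx
  refine ⟨(y, x), mem_iInter.2 fun k => ?_⟩
  rw [hsB k, mem_preimage, huv]
  exact hKB k ((hx k).2 (Fin.last k))

/-- Countable additivity on `Y × (ι → ℝ)` is inherited from the marginal on `Y`. -/
theorem CylindricalProbability.IsCountablyAdditive.of_map_fst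
    {μ : CylindricalProbability (Y × (ι → ℝ))}
    (hμ : (μ.map (ContinuousLinearMap.fst ℝ Y (ι → ℝ))).IsCountablyAdditive) :
    μ.IsCountablyAdditive := by
  intro C hC hd hU
  refine addContent_iUnion_eq_sum_of_tendsto_zero isSetRing_cylinderSets μ.content
    (fun s hs => ((μ.apply_le_one hs).trans_lt ENNReal.one_lt_top).ne) ?_ hC hU hd
  intro s hs hanti hempty
  have hm : Antitone fun k => μ.content (s k) := fun k l hkl => μ.mono (hs l) (hs k) (hanti hkl)
  have hinf : ⨅ k, μ.content (s k) = 0 := by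
    by_contra hne
    exact (nonempty_iInter_of_map_fst hμ hs hanti hne fun k => iInf_le _ k).ne_empty hempty
  simpa only [hinf] using tendsto_atTop_iInf hm

end CountableAdditivity

/-! ### Cylindrical probabilities from measures on a power of `ℝ` -/

section HamelBasis

variable {Z ι : Type*} [AddCommGroup Z] [Module ℝ Z] [TopologicalSpace Z]
  (e : Module.Basis ι ℝ (Z →L[ℝ] ℝ))

/-- The evaluation map `z ↦ (e i z)_i` at the members of a Hamel basis `e` of the dual of `Z`. -/
noncomputable def basisEval : Z →L[ℝ] (ι → ℝ) :=
  ContinuousLinearMap.pi fun i => e i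

/-- The factorization of a continuous linear map `b : Z → ℝⁿ` through `basisEval e`: component `k`
is the finite linear combination of coordinates with the coefficients of `b k` in the basis `e`. -/
noncomputable def basisLift {n : ℕ} (b : Z →L[ℝ] (Fin n → ℝ)) : (ι → ℝ) →L[ℝ] (Fin n → ℝ) :=
  ContinuousLinearMap.pi fun k =>
    let c := e.repr ((ContinuousLinearMap.proj k).comp b)
    ∑ i ∈ c.support, c i • ContinuousLinearMap.proj i

theorem basisLift_apply {n : ℕ} (b : Z →L[ℝ] (Fin n → ℝ)) (x : ι → ℝ) (k : Fin n) :
    basisLift e b x k = e.constr ℝ x ((ContinuousLinearMap.proj k).comp b) := by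
  simp [basisLift, Module.Basis.constr_apply, Finsupp.sum]

theorem measurable_basisLift {n : ℕ} (b : Z →L[ℝ] (Fin n → ℝ)) : Measurable (basisLift e b) := by
  rw [measurable_pi_iff]
  intro k
  simp only [basisLift_apply, Module.Basis.constr_apply, Finsupp.sum, smul_eq_mul]
  exact Finset.measurable_sum _ fun i _ => (measurable_pi_apply i).const_mul _

theorem basisLift_basisEval {n : ℕ} (b : Z →L[ℝ] (Fin n → ℝ)) (z : Z) :
    basisLift e b (basisEval e z) = b z := by
  ext k
  have h : e.constr ℝ (basisEval e z) = 
      { toFun := fun f => f z, map_add' := fun _ _ => rfl, map_smul' := fun _ _ => rfl } := by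
    refine e.ext fun i => ?_
    rw [Module.Basis.constr_basis]
    rfl
  rw [basisLift_apply, h]
  rfl

/-- On finitely many members of the dual of `Z`, every linear functional on the dual is evaluation
at a point of `Z`. -/
theorem exists_forall_apply_eq_of_dual {κ : Type*} [Fintype κ] (g : κ → Z →L[ℝ] ℝ)
    (L : (Z →L[ℝ] ℝ) →ₗ[ℝ] ℝ) : ∃ z, ∀ k, g k z = L (g k) := by
  classical
  let G : Z →ₗ[ℝ] (κ → ℝ) := LinearMap.pi fun k => (g k : Z →ₗ[ℝ] ℝ)
  suffices h : (fun k => L (g k)) ∈ LinearMap.range G by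
    obtain ⟨z, hz⟩ := h
    exact ⟨z, fun k => congrFun hz k⟩
  by_contra hnot
  obtain ⟨φ, hφ, hker⟩ := Submodule.exists_le_ker_of_notMem hnot
  refine hφ ?_
  have hsum (a : κ → ℝ) : φ a = ∑ k, φ (Pi.single k 1) * a k := by
    conv_lhs => rw [pi_eq_sum_univ' a, map_sum]
    exact Finset.sum_congr rfl fun k _ => by rw [map_smul, smul_eq_mul, mul_comm]
  have hzero : ∑ k, φ (Pi.single k 1) • g k = 0 := by
    ext z
    have h : φ (G z) = 0 := hker ⟨z, rfl⟩
    rw [hsum] at h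
    simpa [G] using h
  have h := congrArg L hzero
  rw [map_sum, map_zero] at h
  rw [hsum]
  simpa only [map_smul, smul_eq_mul] using h

variable (Z) in
/-- The subset of `ι → ℝ` corresponding to a cylinder set `C` of `Z`. It is
`basisLift e u ⁻¹' B` for every representation `C = u ⁻¹' B`, see `basisPullback_preimage`. -/
def basisPullback (C : Set Z) : Set (ι → ℝ) :=
  {x | ∃ (n : ℕ) (u : Z →L[ℝ] (Fin n → ℝ)) (B : Set (Fin n → ℝ)),
    MeasurableSet B ∧ C = u ⁻¹' B ∧ basisLift e u x ∈ B}

theorem exists_apply_eq_basisLift {k l : ℕ} (u : Z →L[ℝ] (Fin k → ℝ)) (v : Z →L[ℝ] (Fin l → ℝ))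
    (x : ι → ℝ) : ∃ z, u z = basisLift e u x ∧ v z = basisLift e v x := by
  obtain ⟨z, hz⟩ := exists_forall_apply_eq_of_dual
    (Sum.elim (fun i => (ContinuousLinearMap.proj i).comp u)
      (fun i => (ContinuousLinearMap.proj i).comp v)) (e.constr ℝ x)
  refine ⟨z, funext fun i => ?_, funext fun i => ?_⟩
  · rw [basisLift_apply]
    exact hz (Sum.inl i)
  · rw [basisLift_apply]
    exact hz (Sum.inr i)

theorem basisPullback_preimage {n : ℕ} (u : Z →L[ℝ] (Fin n → ℝ)) {B : Set (Fin n → ℝ)}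
    (hB : MeasurableSet B) : basisPullback Z e (u ⁻¹' B) = basisLift e u ⁻¹' B := by
  ext x
  constructor
  · rintro ⟨k, v, A, hA, hAB, hx⟩
    obtain ⟨z, hzu, hzv⟩ := exists_apply_eq_basisLift e u v x
    have hz : z ∈ v ⁻¹' A := by rwa [mem_preimage, hzv]
    rw [← hAB, mem_preimage, hzu] at hz
    exact hz
  · exact fun hx => ⟨n, u, B, hB, rfl, hx⟩

/-- A probability measure on `ι → ℝ` induces a cylindrical probability on `Z`, although the image of
`basisEval e` may be a proper subset of outer measure less than one. -/
theorem exists_cylindricalProbability_preimage (ν : Measure (ι → ℝ)) [IsProbabilityMeasure ν] :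
    ∃ μ : CylindricalProbability Z, ∀ (n : ℕ) (b : Z →L[ℝ] (Fin n → ℝ)) (E : Set (Fin n → ℝ)),
      MeasurableSet E → μ (b ⁻¹' E) = ν (basisLift e b ⁻¹' E) := by
  refine ⟨⟨isSetRing_cylinderSets.addContent_of_union (fun C => ν (basisPullback Z e C)) ?_ ?_,
    ?_, ?_⟩, ?_⟩
  · have h : (∅ : Set Z) = (0 : Z →L[ℝ] (Fin 0 → ℝ)) ⁻¹' ∅ := rfl
    rw [h, basisPullback_preimage e _ MeasurableSet.empty, preimage_empty, measure_empty]
  · intro C D hC hD hCD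
    obtain ⟨n, u, A, B, hA, hB, rfl, rfl⟩ := exists_common_cylinder hC hD
    rw [← preimage_union, basisPullback_preimage e u hA, basisPullback_preimage e u hB,
      basisPullback_preimage e u (hA.union hB), preimage_union,
      measure_union _ (hB.preimage (measurable_basisLift e u))]
    rw [Set.disjoint_left]
    intro x hxA hxB
    obtain ⟨z, hz, -⟩ := exists_apply_eq_basisLift e u u x
    rw [mem_preimage, ← hz] at hxA hxB
    exact Set.disjoint_left.1 hCD hxA hxB
  · have h : (univ : Set Z) = (0 : Z →L[ℝ] (Fin 0 → ℝ)) ⁻¹' univ := rfl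
    change ν (basisPullback Z e univ) = 1
    rw [h, basisPullback_preimage e _ MeasurableSet.univ, preimage_univ, measure_univ]
  · intro n u B hB hd
    change ν (basisPullback Z e _) = ∑' i, ν (basisPullback Z e _)
    rw [basisPullback_preimage e u (MeasurableSet.iUnion hB), preimage_iUnion,
      measure_iUnion (fun i j hij => (hd hij).preimage _)
        (fun i => (hB i).preimage (measurable_basisLift e u))]
    exact tsum_congr fun i => by rw [basisPullback_preimage e u (hB i)]
  · intro n b E hE
    change ν (basisPullback Z e _) = _
    rw [basisPullback_preimage e b hE]

end HamelBasis

/-! ### The completed sigma-algebra -/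

namespace CylindricalProbability

section Completion

variable {E : Type*} [AddCommGroup E] [Module ℝ E] [TopologicalSpace E]

theorem isPiSystem_cylinderSets : IsPiSystem (cylinderSets E) := fun _ hC _ hD _ =>
  isSetRing_cylinderSets.inter_mem hC hD

variable {μ : CylindricalProbability E} (hμ : μ.IsCountablyAdditive)

theorem IsCountablyAdditive.generateFrom_le_completedSigmaAlgebra :
    MeasurableSpace.generateFrom (cylinderSets E) ≤ hμ.completedSigmaAlgebra := fun _ hs =>
  let _ : MeasurableSpace E := MeasurableSpace.generateFrom (cylinderSets E)
  MeasurableSet.nullMeasurableSet hs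

theorem IsCountablyAdditive.completedMeasure_apply (s : Set E) :
    hμ.completedMeasure s = hμ.extension s :=
  let _ : MeasurableSpace E := MeasurableSpace.generateFrom (cylinderSets E)
  Measure.completion_apply _ s

theorem IsCountablyAdditive.isProbabilityMeasure_completedMeasure :
    IsProbabilityMeasure hμ.completedMeasure :=
  ⟨(hμ.completedMeasure_apply univ).trans hμ.isProbabilityMeasure_extension.measure_univ⟩

theorem IsCountablyAdditive.trim_completedMeasure :
    hμ.completedMeasure.trim hμ.generateFrom_le_completedSigmaAlgebra = hμ.extension := by
  refine @Measure.ext _ (MeasurableSpace.generateFrom (cylinderSets E)) _ _ fun s hs => ?_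
  rw [trim_measurableSet_eq _ hs, hμ.completedMeasure_apply]

theorem IsCountablyAdditive.lintegral_completedMeasure {f : E → ℝ≥0∞}
    (hf : Measurable[MeasurableSpace.generateFrom (cylinderSets E)] f) :
    ∫⁻ x, f x ∂hμ.completedMeasure = ∫⁻ x, f x ∂hμ.extension := by
  rw [← hμ.trim_completedMeasure, lintegral_trim _ hf]

theorem eq_on_generateFrom_cylinderSets {mE : MeasurableSpace E}
    (hle : MeasurableSpace.generateFrom (cylinderSets E) ≤ mE) {ν ν' : Measure E}
    [IsFiniteMeasure ν] (h : ∀ C ∈ cylinderSets E, ν C = ν' C) {s : Set E}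
    (hs : MeasurableSet[MeasurableSpace.generateFrom (cylinderSets E)] s) : ν s = ν' s := by
  have key : ν.trim hle = ν'.trim hle := by
    have := isFiniteMeasure_trim (μ := ν) hle
    refine ext_of_generate_finite (cylinderSets E) rfl isPiSystem_cylinderSets (fun C hC => ?_) ?_
    · have hC' := MeasurableSpace.measurableSet_generateFrom hC
      rw [trim_measurableSet_eq _ hC', trim_measurableSet_eq _ hC', h C hC]
    · rw [trim_measurableSet_eq _ MeasurableSet.univ, trim_measurableSet_eq _ MeasurableSet.univ,
        h _ univ_mem_cylinderSets]
  rw [← trim_measurableSet_eq hle hs, key, trim_measurableSet_eq hle hs]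

/-- Finite measures on the completed sigma-algebra that agree on cylinder sets are equal if one of
them vanishes on the null sets of the sigma-algebra generated by the cylinder sets. -/
theorem IsCountablyAdditive.eq_on_completedSigmaAlgebra
    {ν ν' : @Measure E hμ.completedSigmaAlgebra} [IsFiniteMeasure ν]
    (h : ∀ C ∈ cylinderSets E, ν C = ν' C)
    (hac : ∀ s, MeasurableSet[MeasurableSpace.generateFrom (cylinderSets E)] s →
      hμ.extension s = 0 → ν s = 0) {F : Set E} (hF : MeasurableSet[hμ.completedSigmaAlgebra] F) :
    ν F = ν' F := by
  have heq {s : Set E} (hs : MeasurableSet[MeasurableSpace.generateFrom (cylinderSets E)] s) :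
      ν s = ν' s := eq_on_generateFrom_cylinderSets hμ.generateFrom_le_completedSigmaAlgebra h hs
  obtain ⟨F₀, hF₀, N, hN, hN0, hsub, hsup⟩ : ∃ F₀,
      MeasurableSet[MeasurableSpace.generateFrom (cylinderSets E)] F₀ ∧ ∃ N,
      MeasurableSet[MeasurableSpace.generateFrom (cylinderSets E)] N ∧ hμ.extension N = 0 ∧
      F ⊆ F₀ ∧ F₀ ⊆ F ∪ N := by
    let _ : MeasurableSpace E := MeasurableSpace.generateFrom (cylinderSets E)
    obtain ⟨F₀, hsub, hF₀, hae⟩ := NullMeasurableSet.exists_measurable_superset_ae_eq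
      (μ := hμ.extension) hF
    refine ⟨F₀, hF₀, toMeasurable hμ.extension (F₀ \ F), measurableSet_toMeasurable _ _, ?_, hsub,
      ?_⟩
    · rw [measure_toMeasurable]
      exact (ae_le_set.1 hae.le)
    · intro x hx
      by_cases hxF : x ∈ F
      · exact Or.inl hxF
      · exact Or.inr (subset_toMeasurable _ _ ⟨hx, hxF⟩)
  have hval {η : @Measure E hμ.completedSigmaAlgebra} (hη : η N = 0) : η F = η F₀ :=
    le_antisymm (measure_mono hsub) ((measure_mono hsup).trans
      ((measure_union_le _ _).trans_eq (by rw [hη, add_zero])))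
  have hνN := hac N hN hN0
  rw [hval hνN, hval ((heq hN).symm.trans hνN), heq hF₀]

end Completion

/-! ### Disintegration of cylindrical probabilities -/

section Product

variable {Y : Type*} [AddCommGroup Y] [Module ℝ Y] [TopologicalSpace Y]

theorem measurableSet_prod_of_mem_cylinderSets [mY : MeasurableSpace Y]
    (hY : MeasurableSpace.generateFrom (cylinderSets Y) ≤ mY) {n : ℕ}
    {A : Set (Y × (Fin n → ℝ))} (hA : A ∈ cylinderSets (Y × (Fin n → ℝ))) : MeasurableSet A := by
  obtain ⟨k, w, B, hB, rfl⟩ := hA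
  have h1 : Measurable (w.comp (ContinuousLinearMap.inl ℝ Y (Fin n → ℝ))) :=
    (measurable_generateFrom_cylinderSets _).mono hY le_rfl
  have h2 : Measurable (w.comp (ContinuousLinearMap.inr ℝ Y (Fin n → ℝ))) :=
    ContinuousLinearMap.measurable _
  have hw : ⇑w = fun p => w.comp (ContinuousLinearMap.inl ℝ Y (Fin n → ℝ)) p.1 +
      w.comp (ContinuousLinearMap.inr ℝ Y (Fin n → ℝ)) p.2 := by
    ext p : 1
    simp [← map_add]
  refine hB.preimage ?_
  rw [hw]
  exact (h1.comp measurable_fst).add (h2.comp measurable_snd)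

theorem prod_mem_cylinderSets {F : Set Y} (hF : F ∈ cylinderSets Y) {n : ℕ}
    {E : Set (Fin n → ℝ)} (hE : MeasurableSet E) : F ×ˢ E ∈ cylinderSets (Y × (Fin n → ℝ)) := by
  rw [prod_eq]
  exact isSetRing_cylinderSets.inter_mem
    (preimage_mem_cylinderSets_of_mem (ContinuousLinearMap.fst ℝ Y (Fin n → ℝ)) hF)
    (preimage_mem_cylinderSets (ContinuousLinearMap.snd ℝ Y (Fin n → ℝ)) hE)

variable {Z ι : Type*} [AddCommGroup Z] [Module ℝ Z] [TopologicalSpace Z]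

/-- A cylindrical probability on `Y × Z` with countably additive first marginal is given on cylinder
sets by a kernel from `Y` to `ι → ℝ`. The kernel is measurable for the sigma-algebra generated by
the cylinder sets, without completion. -/
theorem exists_kernel_apply_eq_lintegral (e : Module.Basis ι ℝ (Z →L[ℝ] ℝ))
    (m : CylindricalProbability (Y × Z))
    (hm : (m.map (ContinuousLinearMap.fst ℝ Y Z)).IsCountablyAdditive) :
    letI : MeasurableSpace Y := MeasurableSpace.generateFrom (cylinderSets Y)
    ∃ κ : Kernel Y (ι → ℝ), IsMarkovKernel κ ∧
      ∀ (n : ℕ) (b : Z →L[ℝ] (Fin n → ℝ)), ∀ A ∈ cylinderSets (Y × (Fin n → ℝ)),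
        m.map ((ContinuousLinearMap.id ℝ Y).prodMap b) A =
          ∫⁻ y, κ y {x | (y, basisLift e b x) ∈ A} ∂hm.extension := by
  let mY : MeasurableSpace Y := MeasurableSpace.generateFrom (cylinderSets Y)
  let m' := m.map ((ContinuousLinearMap.id ℝ Y).prodMap (basisEval e))
  have hm' : m'.IsCountablyAdditive :=
    IsCountablyAdditive.of_map_fst fun C hC hd hU => hm C hC hd hU
  have hid : @Measurable _ _ (MeasurableSpace.generateFrom (cylinderSets (Y × (ι → ℝ)))) _
      (id : Y × (ι → ℝ) → Y × (ι → ℝ)) := by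
    refine measurable_id'' (sup_le (Measurable.comap_le ?_) (Measurable.comap_le ?_))
    · exact @measurable_generateFrom _ _ (MeasurableSpace.generateFrom _) _ _ fun C hC =>
        MeasurableSpace.measurableSet_generateFrom (preimage_mem_cylinderSets_of_mem
          (ContinuousLinearMap.fst ℝ Y (ι → ℝ)) hC)
    · exact (@measurable_pi_iff _ _ _ (MeasurableSpace.generateFrom _) _ _).2 fun i =>
        measurable_generateFrom_cylinderSets
          ((ContinuousLinearMap.proj i).comp (ContinuousLinearMap.snd ℝ Y (ι → ℝ)))
  let ρ : Measure (Y × (ι → ℝ)) := @Measure.map _ _ (MeasurableSpace.generateFrom _) _ id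
    hm'.extension
  have hρ {A : Set (Y × (ι → ℝ))} (hA : MeasurableSet A)
      (hAc : A ∈ cylinderSets (Y × (ι → ℝ))) :
      ρ A = m (((ContinuousLinearMap.id ℝ Y).prodMap (basisEval e)) ⁻¹' A) := by
    rw [Measure.map_apply hid hA]
    exact hm'.extension_apply hAc
  have : IsProbabilityMeasure ρ := ⟨by
    rw [hρ MeasurableSet.univ univ_mem_cylinderSets]
    exact m.content_univ⟩
  have hfst : ρ.fst = hm.extension := by
    refine Measure.ext fun s hs =>
      eq_on_generateFrom_cylinderSets (mE := mY) le_rfl (fun C hC => ?_) hs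
    have hCm := MeasurableSpace.measurableSet_generateFrom hC
    rw [Measure.fst_apply hCm, hρ (hCm.preimage measurable_fst)
      (preimage_mem_cylinderSets_of_mem (ContinuousLinearMap.fst ℝ Y (ι → ℝ)) hC),
      hm.extension_apply hC]
    rfl
  obtain ⟨κ, hκ, hκρ⟩ := exists_kernel_compProd_eq ρ
  refine ⟨κ, hκ, fun n b A hA => ?_⟩
  let T : Y × (ι → ℝ) →L[ℝ] Y × (Fin n → ℝ) :=
    (ContinuousLinearMap.id ℝ Y).prodMap (basisLift e b)
  have hTA : MeasurableSet (T ⁻¹' A) :=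
    (measurableSet_prod_of_mem_cylinderSets le_rfl hA).preimage
      (measurable_fst.prodMk ((measurable_basisLift e b).comp measurable_snd))
  have h1 := hρ hTA (preimage_mem_cylinderSets_of_mem T hA)
  have h2 : (ContinuousLinearMap.id ℝ Y).prodMap (basisEval e) ⁻¹' (T ⁻¹' A) =
      ((ContinuousLinearMap.id ℝ Y).prodMap b) ⁻¹' A := by
    ext p
    change (p.1, basisLift e b (basisEval e p.2)) ∈ A ↔ (p.1, b p.2) ∈ A
    rw [basisLift_basisEval]
  have := hm.isProbabilityMeasure_extension
  rw [map_apply, ← h2, ← h1, ← hκρ, hfst]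
  exact Measure.compProd_apply hTA

/-- Any extension of `(I × b)[m]` to the product of the completed and the Borel sigma-algebra is
given on rectangles by the disintegrating kernel. -/
theorem isExtendedBy_apply_prod (e : Module.Basis ι ℝ (Z →L[ℝ] ℝ))
    (m : CylindricalProbability (Y × Z))
    (hm : (m.map (ContinuousLinearMap.fst ℝ Y Z)).IsCountablyAdditive)
    (κ : @Kernel Y (ι → ℝ) (MeasurableSpace.generateFrom (cylinderSets Y)) _) [IsMarkovKernel κ]
    {n : ℕ} (b : Z →L[ℝ] (Fin n → ℝ))
    (hκ : ∀ A ∈ cylinderSets (Y × (Fin n → ℝ)),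
        m.map ((ContinuousLinearMap.id ℝ Y).prodMap b) A =
          ∫⁻ y, κ y {x | (y, basisLift e b x) ∈ A} ∂hm.extension) :
    letI : MeasurableSpace Y := hm.completedSigmaAlgebra
    ∀ S : Measure (Y × (Fin n → ℝ)),
      (m.map ((ContinuousLinearMap.id ℝ Y).prodMap b)).IsExtendedBy S →
      ∀ F : Set Y, MeasurableSet F → ∀ E : Set (Fin n → ℝ), MeasurableSet E →
        S (F ×ˢ E) = ∫⁻ y in F, κ y (basisLift e b ⁻¹' E) ∂hm.completedMeasure := by
  let mY : MeasurableSpace Y := hm.completedSigmaAlgebra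
  intro S hS F hF E hE
  have hSfin : IsFiniteMeasure S := ⟨by
    rw [(hS _ univ_mem_cylinderSets).2]
    exact (apply_le_one _ univ_mem_cylinderSets).trans_lt ENNReal.one_lt_top⟩
  have hle := hm.generateFrom_le_completedSigmaAlgebra
  let ν : Measure Y := (S.restrict (univ ×ˢ E)).fst
  have hν {s : Set Y} (hs : MeasurableSet s) : ν s = S (s ×ˢ E) := by
    rw [Measure.fst_apply hs, Measure.restrict_apply (hs.preimage measurable_fst)]
    congr 1
    ext
    simp
  have hκm : Measurable[MeasurableSpace.generateFrom (cylinderSets Y)]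
      fun y => κ y (basisLift e b ⁻¹' E) :=
    κ.measurable_coe (hE.preimage (measurable_basisLift e b))
  -- The first marginal of `S` and the completed measure agree before completion.
  have hmarg {s : Set Y} (hs : MeasurableSet[MeasurableSpace.generateFrom (cylinderSets Y)] s) :
      S.fst s = hm.completedMeasure s := by
    refine eq_on_generateFrom_cylinderSets hle (fun C hC => ?_) hs
    rw [hm.completedMeasure_apply, hm.extension_apply hC, Measure.fst_apply
      (hle _ (MeasurableSpace.measurableSet_generateFrom hC))]
    exact (hS _ (preimage_mem_cylinderSets_of_mem (ContinuousLinearMap.fst ℝ Y _) hC)).2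
  have key := hm.eq_on_completedSigmaAlgebra (ν := ν)
    (ν' := hm.completedMeasure.withDensity fun y => κ y (basisLift e b ⁻¹' E))
    (fun C hC => ?_) (fun s hs hs0 => ?_) hF
  · rw [← hν hF, key, withDensity_apply _ hF]
  · have hCm := MeasurableSpace.measurableSet_generateFrom hC
    have hC' : MeasurableSet C := hle _ hCm
    rw [hν hC', withDensity_apply _ hC', (hS _ (prod_mem_cylinderSets hC hE)).2,
      hκ _ (prod_mem_cylinderSets hC hE), ← lintegral_indicator hC',
      hm.lintegral_completedMeasure (hκm.indicator hCm)]
    congr 1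
    ext y
    by_cases hy : y ∈ C
    · simp [hy]
      rfl
    · simp [hy]
  · refine measure_mono_null (t := s ×ˢ univ) ?_ ?_ |> fun h => (hν (hle _ hs)).trans h
    · exact prod_mono le_rfl (subset_univ _)
    · have h := hmarg hs
      rw [hm.completedMeasure_apply, hs0, Measure.fst_apply (hle _ hs)] at h
      rwa [prod_univ]

/-- The completed measure composed with the disintegrating kernel extends `(I × b)[m]`. -/
theorem exists_isExtendedBy (e : Module.Basis ι ℝ (Z →L[ℝ] ℝ))
    (m : CylindricalProbability (Y × Z))
    (hm : (m.map (ContinuousLinearMap.fst ℝ Y Z)).IsCountablyAdditive)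
    (κ : @Kernel Y (ι → ℝ) (MeasurableSpace.generateFrom (cylinderSets Y)) _) [IsMarkovKernel κ]
    {n : ℕ} (b : Z →L[ℝ] (Fin n → ℝ))
    (hκ : ∀ A ∈ cylinderSets (Y × (Fin n → ℝ)),
        m.map ((ContinuousLinearMap.id ℝ Y).prodMap b) A =
          ∫⁻ y, κ y {x | (y, basisLift e b x) ∈ A} ∂hm.extension) :
    letI : MeasurableSpace Y := hm.completedSigmaAlgebra
    ∃ S : Measure (Y × (Fin n → ℝ)),
      (m.map ((ContinuousLinearMap.id ℝ Y).prodMap b)).IsExtendedBy S := by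
  let mY : MeasurableSpace Y := hm.completedSigmaAlgebra
  have hle := hm.generateFrom_le_completedSigmaAlgebra
  have := hm.isProbabilityMeasure_completedMeasure
  let κ' : Kernel Y (ι → ℝ) := ⟨fun y => κ y, κ.measurable.mono hle le_rfl⟩
  have : IsMarkovKernel κ' := ⟨fun y => inferInstanceAs (IsProbabilityMeasure (κ y))⟩
  have hT : Measurable (Prod.map id (basisLift e b) : Y × (ι → ℝ) → Y × (Fin n → ℝ)) :=
    measurable_id.prodMap (measurable_basisLift e b)
  refine ⟨(hm.completedMeasure ⊗ₘ κ').map (Prod.map id (basisLift e b)), fun A hA => ?_⟩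
  have hAm : MeasurableSet A := measurableSet_prod_of_mem_cylinderSets hle hA
  refine ⟨hAm, ?_⟩
  rw [Measure.map_apply hT hAm, Measure.compProd_apply (hAm.preimage hT), hκ A hA]
  refine hm.lintegral_completedMeasure ?_
  let _ : MeasurableSpace Y := MeasurableSpace.generateFrom (cylinderSets Y)
  exact Kernel.measurable_kernel_prodMk_left (κ := κ)
    ((measurableSet_prod_of_mem_cylinderSets le_rfl hA).preimage
      (measurable_id.prodMap (measurable_basisLift e b)))

end Product

end CylindricalProbability

theorem theorem2 {Y Z : Type*}
    [AddCommGroup Y] [Module ℝ Y] [TopologicalSpace Y] [IsTopologicalAddGroup Y]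
    [ContinuousSMul ℝ Y] [LocallyConvexSpace ℝ Y]
    [AddCommGroup Z] [Module ℝ Z] [TopologicalSpace Z] [IsTopologicalAddGroup Z]
    [ContinuousSMul ℝ Z] [LocallyConvexSpace ℝ Z]
    (m : CylindricalProbability (Y × Z))
    (hm : (m.map (ContinuousLinearMap.fst ℝ Y Z)).IsCountablyAdditive) :
    letI : MeasurableSpace Y := hm.completedSigmaAlgebra
    (∀ (n : ℕ) (b : Z →L[ℝ] (Fin n → ℝ)), ∃! S : Measure (Y × (Fin n → ℝ)),
      (m.map ((ContinuousLinearMap.id ℝ Y).prodMap b)).IsExtendedBy S) ∧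
    ∃ μ : Y → CylindricalProbability Z,
      ∀ (n : ℕ) (b : Z →L[ℝ] (Fin n → ℝ)) (E : Set (Fin n → ℝ)), MeasurableSet E →
        Measurable (fun y => (μ y).map b E) ∧
        ∀ F : Set Y, MeasurableSet F → ∀ S : Measure (Y × (Fin n → ℝ)),
          (m.map ((ContinuousLinearMap.id ℝ Y).prodMap b)).IsExtendedBy S →
            S (F ×ˢ E) = ∫⁻ y in F, (μ y).map b E ∂hm.completedMeasure := by
  let mY : MeasurableSpace Y := hm.completedSigmaAlgebra
  let e := Module.Basis.ofVectorSpace ℝ (Z →L[ℝ] ℝ)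
  obtain ⟨κ, hκ, hκm⟩ := CylindricalProbability.exists_kernel_apply_eq_lintegral e m hm
  have hval {n : ℕ} (b : Z →L[ℝ] (Fin n → ℝ)) :=
    CylindricalProbability.isExtendedBy_apply_prod e m hm κ b (hκm n b)
  refine ⟨fun n b => ?_, ?_⟩
  · obtain ⟨S, hS⟩ := CylindricalProbability.exists_isExtendedBy e m hm κ b (hκm n b)
    have hSfin : IsFiniteMeasure S := ⟨by
      rw [(hS _ univ_mem_cylinderSets).2]
      exact (CylindricalProbability.apply_le_one _ univ_mem_cylinderSets).trans_lt
        ENNReal.one_lt_top⟩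
    refine ⟨S, hS, fun S' hS' => (Measure.ext_prod fun {F E} hF hE => ?_).symm⟩
    rw [hval b S hS F hF E hE, hval b S' hS' F hF E hE]
  · choose μ hμ using fun y => exists_cylindricalProbability_preimage e (κ y)
    refine ⟨μ, fun n b E hE => ?_⟩
    simp only [CylindricalProbability.map_apply, hμ _ n b E hE]
    exact ⟨(κ.measurable_coe (hE.preimage (measurable_basisLift e b))).mono
      hm.generateFrom_le_completedSigmaAlgebra le_rfl, fun F hF S hS => hval b S hS F hF E hE⟩
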